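/- Let $X$ be a real or complex Banach space and let $T$ be a power-bounded bounded linear operator on $X$, i.e. $\sup_{n\ge 0}\|T^n\|<\infty$. Assume that $T=\alpha I+S$, where $\alpha$ is a scalar and $S$ is a bounded linear operator on $X$ such that $S^k$ is compact for some integer $k\ge 1$. Then for every $x\in X$ the following are equivalent: (i) there exists a strictly increasing sequence $(n_j)$ of natural numbers such that $T^{n_j}x\to 0$ weakly; (ii) $\displaystyle \frac1n\sum_{m=1}^n |\langle x^*,T^m x\rangle|\to 0$ as $n\to\infty$, for every $x^*\in X^*$; (iii) $\|T^n x\|\to 0$ as $n\to\infty$. -/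

import Mathlib

open Filter Topology

/-- A bounded linear operator `T` is power-bounded if `sup_n ‖T ^ n‖ < ∞`. -/
def IsPowerBounded {𝕜 X : Type*} [RCLike 𝕜] [NormedAddCommGroup X] [NormedSpace 𝕜 X]
    (T : X →L[𝕜] X) : Prop :=
  ∃ C : ℝ, ∀ n : ℕ, ‖T ^ n‖ ≤ C

/-! Both (i) and (ii) put zero in the weak closure of the orbit of `x`, and this already forces norm
convergence. The compact operator `S ^ k` commutes with `T` and sends the bounded orbit into a
compact set, where weak and norm accumulation at zero agree; power-boundedness then makes `S ^ k x`
stable. Since `S = T - α`, each `S ^ j x` is an eigenvector of `T` modulo the closed stable subspace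
once `S ^ (j + 1) x` is stable, so stability descends to `x`. -/

section WeakOrbits

variable {𝕜 X : Type*} [RCLike 𝕜] [NormedAddCommGroup X] [NormedSpace 𝕜 X]

/-- The subspace of vectors whose orbit under `T` converges to zero in norm. -/
def stableSubspace (T : X →L[𝕜] X) : Submodule 𝕜 X where
  carrier := {x | Tendsto (fun n : ℕ => (T ^ n) x) atTop (𝓝 0)}
  add_mem' {x y} hx hy := by simpa using Tendsto.add hx hy
  zero_mem' := by simp
  smul_mem' c x hx := by
    simpa only [Set.mem_ofPred_eq, map_smul, smul_zero] using Tendsto.const_smul hx c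

theorem mem_stableSubspace {T : X →L[𝕜] X} {x : X} :
    x ∈ stableSubspace T ↔ Tendsto (fun n : ℕ => (T ^ n) x) atTop (𝓝 0) :=
  Iff.rfl

theorem stableSubspace_map_mem {T A : X →L[𝕜] X} (h : Commute A T) {x : X}
    (hx : x ∈ stableSubspace T) : A x ∈ stableSubspace T := by
  rw [mem_stableSubspace] at hx ⊢
  have hA : ∀ n : ℕ, (T ^ n) (A x) = A ((T ^ n) x) := fun n =>
    (DFunLike.congr_fun (h.pow_right n).eq x).symm
  simpa only [hA, map_zero, Function.comp_def] using (A.continuous.tendsto 0).comp hx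

/-- An orbit of a power-bounded operator that comes arbitrarily close to zero converges to zero. -/
theorem mem_stableSubspace_of_forall_exists_norm_lt {T : X →L[𝕜] X} (hT : IsPowerBounded T) {x : X}
    (h : ∀ ε > 0, ∃ m : ℕ, ‖(T ^ m) x‖ < ε) : x ∈ stableSubspace T := by
  obtain ⟨C, hC⟩ := hT
  have hC0 : 0 ≤ C := (norm_nonneg _).trans (hC 0)
  rw [mem_stableSubspace, Metric.tendsto_atTop]
  intro ε hε
  obtain ⟨m, hm⟩ := h (ε / (C + 1)) (by positivity)
  refine ⟨m, fun n hn => ?_⟩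
  obtain ⟨p, rfl⟩ := Nat.exists_eq_add_of_le' hn
  rw [dist_zero_right, pow_add, mul_apply_eq_comp]
  rw [lt_div_iff₀ (by positivity)] at hm
  have := (T ^ p).le_of_opNorm_le (hC p) ((T ^ m) x)
  nlinarith [norm_nonneg ((T ^ m) x)]

theorem isClosed_stableSubspace {T : X →L[𝕜] X} (hT : IsPowerBounded T) :
    IsClosed (stableSubspace T : Set X) := by
  refine isClosed_of_closure_subset fun x hx => ?_
  refine mem_stableSubspace_of_forall_exists_norm_lt hT fun ε hε => ?_
  obtain ⟨C, hC⟩ := hT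
  have hC0 : 0 ≤ C := (norm_nonneg _).trans (hC 0)
  obtain ⟨y, hy, hxy⟩ := Metric.mem_closure_iff.1 hx (ε / 2 / (C + 1)) (by positivity)
  obtain ⟨m, hm⟩ := Metric.tendsto_atTop.1 (mem_stableSubspace.1 hy) (ε / 2) (by positivity)
  have hm := hm m le_rfl
  rw [dist_zero_right] at hm
  rw [dist_eq_norm, lt_div_iff₀ (by positivity)] at hxy
  refine ⟨m, ?_⟩
  have h1 := (T ^ m).le_of_opNorm_le (hC m) (x - y)
  have h2 : (T ^ m) x = (T ^ m) (x - y) + (T ^ m) y := by simp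
  have h3 := norm_add_le ((T ^ m) (x - y)) ((T ^ m) y)
  rw [← h2] at h3
  nlinarith [norm_nonneg (x - y)]

/-- Zero lies in the weak closure of the orbit of `x` under `T`. -/
def OrbitWeaklyNearZero (T : X →L[𝕜] X) (x : X) : Prop :=
  ∀ F : Finset (StrongDual 𝕜 X), ∃ m : ℕ, ∀ f ∈ F, ‖f ((T ^ m) x)‖ < 1

theorem OrbitWeaklyNearZero.map {T A : X →L[𝕜] X} {x : X} (hx : OrbitWeaklyNearZero T x)
    (h : Commute A T) : OrbitWeaklyNearZero T (A x) := by
  classical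
  intro F
  obtain ⟨m, hm⟩ := hx (F.image fun f => f.comp A)
  refine ⟨m, fun f hf => ?_⟩
  have hA : (T ^ m) (A x) = A ((T ^ m) x) := (DFunLike.congr_fun (h.pow_right m).eq x).symm
  rw [hA]
  exact hm _ (Finset.mem_image_of_mem _ hf)

/-- The threshold 1 in `OrbitWeaklyNearZero` is harmless: functionals can be rescaled by `ε⁻¹`. -/
theorem OrbitWeaklyNearZero.exists_norm_lt {T : X →L[𝕜] X} {x : X} (hx : OrbitWeaklyNearZero T x)
    (f : StrongDual 𝕜 X) {ε : ℝ} (hε : 0 < ε) : ∃ m : ℕ, ‖f ((T ^ m) x)‖ < ε := by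
  obtain ⟨m, hm⟩ := hx {((ε⁻¹ : ℝ) : 𝕜) • f}
  refine ⟨m, ?_⟩
  have := hm _ (Finset.mem_singleton_self _)
  rwa [smul_apply, norm_smul, RCLike.norm_ofReal, abs_of_pos (by positivity),
    inv_mul_lt_iff₀ hε, mul_one] at this

/-- In a compact set, weak and norm accumulation at zero of an orbit coincide. -/
theorem OrbitWeaklyNearZero.mem_stableSubspace_of_isCompact {T : X →L[𝕜] X} {x : X}
    (hx : OrbitWeaklyNearZero T x) (hT : IsPowerBounded T) {K : Set X} (hK : IsCompact K)
    (hxK : ∀ n : ℕ, (T ^ n) x ∈ K) : x ∈ stableSubspace T := by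
  refine mem_stableSubspace_of_forall_exists_norm_lt hT fun ε hε => ?_
  by_contra! hfar
  have hL : IsCompact (K ∩ {y | ε ≤ ‖y‖}) :=
    hK.inter_right (isClosed_le continuous_const continuous_norm)
  obtain ⟨F, hF⟩ := hL.elim_finite_subcover (fun f : StrongDual 𝕜 X => {y | 1 < ‖f y‖})
    (fun f => isOpen_lt continuous_const f.continuous.norm) (by
      rintro y ⟨-, hy⟩
      have hy0 : 0 < ‖y‖ := hε.trans_le hy
      obtain ⟨g, -, hg⟩ := exists_dual_vector 𝕜 y hy0.ne'
      refine Set.mem_iUnion.2 ⟨((2 / ‖y‖ : ℝ) : 𝕜) • g, ?_⟩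
      rw [Set.mem_ofPred_eq, smul_apply, norm_smul, hg, RCLike.norm_ofReal,
        RCLike.norm_ofReal, abs_of_pos (by positivity), abs_of_pos hy0, div_mul_cancel₀ _ hy0.ne']
      norm_num)
  obtain ⟨m, hm⟩ := hx F
  obtain ⟨f, hfF, hf⟩ := Set.mem_iUnion₂.1 (hF ⟨hxK m, hfar m⟩)
  exact lt_asymm (hm f hfF) hf

theorem sub_pow_smul_mem_stableSubspace {T : X →L[𝕜] X} {α : 𝕜} {y : X}
    (hy : T y - α • y ∈ stableSubspace T) (m : ℕ) :
    (T ^ m) y - α ^ m • y ∈ stableSubspace T := by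
  induction m with
  | zero => simp
  | succ m ih =>
    have h := add_mem (stableSubspace_map_mem (Commute.refl T) ih)
      ((stableSubspace T).smul_mem (α ^ m) hy)
    convert h using 1
    simp only [pow_succ', mul_apply_eq_comp, map_sub, map_smul, smul_sub, smul_smul]
    rw [mul_comm α]
    abel

/-- If `y` is an eigenvector of `T` modulo the stable subspace and its orbit accumulates weakly at
zero, then `y` is stable. -/
theorem OrbitWeaklyNearZero.mem_stableSubspace_of_sub_smul_mem {T : X →L[𝕜] X} {α : 𝕜} {y : X}
    (hy : OrbitWeaklyNearZero T y) (hT : IsPowerBounded T)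
    (hα : T y - α • y ∈ stableSubspace T) : y ∈ stableSubspace T := by
  have hmem := sub_pow_smul_mem_stableSubspace hα
  rcases lt_or_ge ‖α‖ 1 with h1 | h1
  -- Choose `m` to make `α ^ m • T ^ n y` small uniformly in `n`, then `n` to kill the stable
  -- remainder.
  · refine mem_stableSubspace_of_forall_exists_norm_lt hT fun ε hε => ?_
    obtain ⟨C, hC⟩ := hT
    have hlim : Tendsto (fun m : ℕ => ‖α‖ ^ m * (C * ‖y‖)) atTop (𝓝 0) := by
      simpa using (tendsto_pow_atTop_nhds_zero_of_lt_one (norm_nonneg α) h1).mul_const (C * ‖y‖)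
    obtain ⟨m, hm⟩ := (hlim.eventually_lt_const (half_pos hε)).exists
    obtain ⟨n, hn⟩ := Metric.tendsto_atTop.1 (mem_stableSubspace.1 (hmem m)) (ε / 2) (half_pos hε)
    have hn := hn n le_rfl
    rw [dist_zero_right] at hn
    refine ⟨n + m, ?_⟩
    have h2 : (T ^ (n + m)) y = (T ^ n) ((T ^ m) y - α ^ m • y) + α ^ m • (T ^ n) y := by
      rw [map_sub, map_smul, sub_add_cancel, pow_add, mul_apply_eq_comp]
    rw [h2]
    have h3 := (T ^ n).le_of_opNorm_le (hC n) y
    calc _ ≤ _ := norm_add_le _ _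
      _ ≤ ‖(T ^ n) ((T ^ m) y - α ^ m • y)‖ + ‖α‖ ^ m * (C * ‖y‖) := by
        rw [norm_smul, norm_pow]
        gcongr
      _ < ε := by linarith
  · by_contra hyN
    -- Closedness and Hahn–Banach give `f` vanishing on the stable subspace with `f y ≠ 0`; then `‖f
    -- (T ^ m y)‖ = ‖α‖ ^ m * ‖f y‖` never drops below `‖f y‖`.
    have hq : ‖(stableSubspace T).mkQ y‖ ≠ 0 := by
      intro h0
      apply hyN
      have := (QuotientAddGroup.norm_mk_eq_zero_iff_mem_closure
        (S := (stableSubspace T).toAddSubgroup)).1 h0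
      exact (isClosed_stableSubspace hT).closure_subset this
    obtain ⟨g, -, hg⟩ := exists_dual_vector 𝕜 ((stableSubspace T).mkQ y) hq
    let f : StrongDual 𝕜 X := g.comp (stableSubspace T).mkQL
    have hf0 : ∀ z ∈ stableSubspace T, f z = 0 := fun z hz => by
      have : (stableSubspace T).mkQ z = 0 := by simpa using hz
      change g ((stableSubspace T).mkQ z) = 0
      rw [this, map_zero]
    have hfy : 0 < ‖f y‖ := by
      change 0 < ‖g ((stableSubspace T).mkQ y)‖
      rw [hg, norm_pos_iff]
      exact_mod_cast hq
    obtain ⟨m, hm⟩ := hy.exists_norm_lt f hfy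
    have hfm : f ((T ^ m) y) = α ^ m * f y := by
      have := hf0 _ (hmem m)
      rwa [map_sub, map_smul, sub_eq_zero, smul_eq_mul] at this
    rw [hfm, norm_mul, norm_pow] at hm
    nlinarith [one_le_pow₀ h1 (n := m)]

/-- Orbits of a power-bounded operator `α + S`, with some power of `S` compact, that accumulate
weakly at zero converge to zero in norm. -/
theorem OrbitWeaklyNearZero.mem_stableSubspace_of_isCompactOperator_pow {T S : X →L[𝕜] X} {α : 𝕜}
    {k : ℕ} {x : X} (hx : OrbitWeaklyNearZero T x) (hT : IsPowerBounded T)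
    (hTS : T = α • ContinuousLinearMap.id 𝕜 X + S)
    (hS : IsCompactOperator (S ^ k : X →L[𝕜] X)) : x ∈ stableSubspace T := by
  have hcomm : Commute S T := by
    rw [hTS]
    exact ((Commute.one_right S).smul_right α).add_right (Commute.refl S)
  have hbase : (S ^ k) x ∈ stableSubspace T := by
    obtain ⟨C, hC⟩ := hT
    obtain ⟨K, hK, hKS⟩ := hS.image_closedBall_subset_compact
      (f := ((S ^ k : X →L[𝕜] X) : X →ₗ[𝕜] X)) (C * ‖x‖)
    refine (hx.map (hcomm.pow_left k)).mem_stableSubspace_of_isCompact ⟨C, hC⟩ hK fun n => ?_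
    refine hKS ⟨(T ^ n) x, ?_, ?_⟩
    · rw [mem_closedBall_zero_iff]
      exact (T ^ n).le_of_opNorm_le (hC n) x
    · exact DFunLike.congr_fun (hcomm.pow_pow k n).eq x
  -- Lower powers of `S` need not be compact; only stability descends.
  clear hS
  induction k with
  | zero => simpa using hbase
  | succ k ih =>
    refine ih ((hx.map (hcomm.pow_left k)).mem_stableSubspace_of_sub_smul_mem (α := α) hT ?_)
    convert hbase using 1
    rw [pow_succ', mul_apply_eq_comp, hTS]
    simp

theorem orbitWeaklyNearZero_of_tendsto {T : X →L[𝕜] X} {x : X} {n : ℕ → ℕ}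
    (h : Tendsto (fun j => toWeakSpace 𝕜 X ((T ^ n j) x)) atTop (𝓝 (toWeakSpace 𝕜 X 0))) :
    OrbitWeaklyNearZero T x := by
  intro F
  have hev : ∀ f ∈ F, ∀ᶠ j in atTop, ‖f ((T ^ n j) x)‖ < 1 := fun f _ => by
    have hf : Tendsto (fun j => f ((T ^ n j) x)) atTop (𝓝 (f 0)) :=
      ((WeakBilin.eval_continuous (topDualPairing 𝕜 X).flip f).tendsto _).comp h
    rw [map_zero] at hf
    exact hf.norm.eventually_lt_const (by simp)
  obtain ⟨j, hj⟩ := ((Finset.eventually_all F).2 hev).exists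
  exact ⟨n j, hj⟩

/-- If at every time some `f ∈ F` had modulus at least 1, the averages summed over the finite set
`F` would stay at least 1. -/
theorem orbitWeaklyNearZero_of_tendsto_average {T : X →L[𝕜] X} {x : X}
    (h : ∀ f : StrongDual 𝕜 X,
      Tendsto (fun n : ℕ => (1 / (n : ℝ)) * ∑ m ∈ Finset.Icc 1 n, ‖f ((T ^ m) x)‖)
        atTop (𝓝 0)) :
    OrbitWeaklyNearZero T x := by
  intro F
  by_contra! hF
  have hsum := tendsto_finsetSum F fun f _ => h f
  rw [Finset.sum_const_zero] at hsum
  refine absurd (ge_of_tendsto hsum (b := 1) ?_) (by norm_num)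
  filter_upwards [eventually_gt_atTop 0] with n hn
  have hn' : (0 : ℝ) < n := by exact_mod_cast hn
  rw [← Finset.mul_sum, Finset.sum_comm, one_div, ← div_eq_inv_mul, le_div_iff₀ hn', one_mul]
  calc (n : ℝ) = ∑ m ∈ Finset.Icc 1 n, (1 : ℝ) := by simp
    _ ≤ _ := Finset.sum_le_sum fun m _ => by
      obtain ⟨f, hf, hfm⟩ := hF m
      exact hfm.trans (Finset.single_le_sum (f := fun f : StrongDual 𝕜 X => ‖f ((T ^ m) x)‖)
        (fun _ _ => norm_nonneg _) hf)

theorem tendsto_average_Icc {u : ℕ → ℝ} (hu : Tendsto u atTop (𝓝 0)) :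
    Tendsto (fun n : ℕ => (1 / (n : ℝ)) * ∑ m ∈ Finset.Icc 1 n, u m) atTop (𝓝 0) := by
  have h := (hu.comp (tendsto_add_atTop_nat 1)).cesaro
  convert h using 2 with n
  rw [one_div, Finset.range_eq_Ico]
  exact congrArg _ (Finset.sum_Ico_add' u 0 n 1).symm

end WeakOrbits

theorem mainTheorem4 {𝕜 : Type*} [RCLike 𝕜] {X : Type*} [NormedAddCommGroup X]
    [NormedSpace 𝕜 X] [CompleteSpace X] (T S : X →L[𝕜] X) (α : 𝕜) (k : ℕ)
    (hT : IsPowerBounded T) (hTS : T = α • ContinuousLinearMap.id 𝕜 X + S)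
    (hk : 1 ≤ k) (hS : IsCompactOperator (S ^ k : X →L[𝕜] X)) (x : X) :
    List.TFAE [
      ∃ n : ℕ → ℕ, StrictMono n ∧
        Tendsto (fun j => toWeakSpace 𝕜 X ((T ^ n j) x)) atTop (𝓝 (toWeakSpace 𝕜 X 0)),
      ∀ f : StrongDual 𝕜 X,
        Tendsto (fun n : ℕ => (1 / (n : ℝ)) * ∑ m ∈ Finset.Icc 1 n, ‖f ((T ^ m) x)‖)
          atTop (𝓝 0),
      Tendsto (fun n : ℕ => ‖(T ^ n) x‖) atTop (𝓝 0)] := by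
  tfae_have 3 → 1 := fun h => by
    refine ⟨id, strictMono_id, ?_⟩
    exact ((toWeakSpaceCLM 𝕜 X).continuous.tendsto 0).comp (tendsto_zero_iff_norm_tendsto_zero.2 h)
  tfae_have 3 → 2 := fun h f => by
    have hf := (f.continuous.tendsto 0).comp (tendsto_zero_iff_norm_tendsto_zero.2 h)
    rw [map_zero] at hf
    exact tendsto_average_Icc (tendsto_zero_iff_norm_tendsto_zero.1 hf)
  tfae_have 1 → 3 := fun ⟨_, _, h⟩ =>
    tendsto_zero_iff_norm_tendsto_zero.1
      ((orbitWeaklyNearZero_of_tendsto h).mem_stableSubspace_of_isCompactOperator_pow hT hTS hS)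
  tfae_have 2 → 3 := fun h =>
    tendsto_zero_iff_norm_tendsto_zero.1
      ((orbitWeaklyNearZero_of_tendsto_average h).mem_stableSubspace_of_isCompactOperator_pow
        hT hTS hS)
  tfae_finish
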